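/- **Setting.** Let $d,\nu\in\mathbb N$, $T>0$, $x_0\in\mathbb R^d$. Let $P\subset\mathbb R^\nu$ be nonempty, compact and convex, let $\alpha\mapsto A(\alpha)\in\mathbb R^{d\times d}$ and $\alpha\mapsto b(\alpha)\in\mathbb R^d$ be continuously differentiable on an open neighbourhood of $P$, and let $\psi:\mathbb R^d\to\mathbb R$ be convex and continuously differentiable with $\{\xi:\psi(\xi)\le 0\}$ compact. Consider the robust $L^1$ optimal control problem $$\inf_{u}\int_0^T|u(t)|\,dt$$ over $u\in L^\infty([0,T];\mathbb R)$ with $u(t)\in[-1,1]$ for a.e. $t$, subject to $\psi(x(T;\alpha))\le 0$ for all $\alpha\in P$, where for each $\alpha\in P$ the trajectory $x(\cdot;\alpha)$ is the absolutely continuous solution on $[0,T]$ of $$\dot x(t;\alpha)=A(\alpha)x(t;\alpha)+b(\alpha)u(t)\ \text{ for a.e. }t,\qquad x(0;\alpha)=x_0 .$$ A feasible process $(u^*,\{x^*(\cdot;\alpha)\}_{\alpha\in P})$ is a *strong local minimizer* if there is $\varepsilon>0$ such that $\int_0^T|u^*|\le\int_0^T|u|$ for every feasible process $(u,\{x(\cdot;\alpha)\}_{\alpha\in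 P})$ with $\|x(t;\alpha)-x^*(t;\alpha)\|\le\varepsilon$ for all $t\in[0,T]$ and $\alpha\in P$. **Theorem.** Let $(u^*,\{x^*(\cdot;\alpha)\}_{\alpha\in P})$ be a strong local minimizer. Then there exist a scalar $\eta\in[0,1]$, a nonnegative Radon measure $\lambda$ on $P$, absolutely continuous arcs $p(\cdot;\alpha):[0,T]\to\mathbb R^d$ defined for $\lambda$-a.e. $\alpha\in P$, and scalars $\mu(\alpha)$, such that: 1. (Nontriviality) $\eta+\lambda(P)=1$, and the multipliers $\eta$ and $\mu(\cdot)$ are not simultaneously zero, i.e. it is not the case that $\eta=0$ and $\mu(\alpha)=0$ for $\lambda$-a.e. $\alpha$. 2. (Adjoint dynamics) For $\lambda$-a.e. $\alpha\in P$, $-\dot p(t;\alpha)=A(\alpha)^\top p(t;\alpha)$ for a.e. $t\in[0,T]$. 3. (Transversality) For $\lambda$-a.e. $\alpha\in P$, $\mu(\alpha)\ge 0$ and $-p(T;\alpha)=\mu(\alpha)\nabla\psi(x^*(T;\alpha))$. 4. (Support and complementarity) $\operatorname{supp}(\lambda)\subset\{\alpha\in P:\psi(x^*(T;\alpha))=0\}$;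 moreover, for every $\alpha\in\operatorname{supp}(\lambda)$, $\mu(\alpha)>0$ only if $\psi(x^*(T;\alpha))=0$. 5. (Hamiltonian maximization) For every $t\in[0,T]$ the functions $p(t;\cdot)$, $p(t;\cdot)^\top b(\cdot)$ and $p(t;\cdot)^\top A(\cdot)x^*(t;\cdot)$ are $\lambda$-integrable over $P$, and for a.e. $t\in[0,T]$ $$u^*(t)\in\operatorname*{arg\,max}_{v\in[-1,1]}\Big(\int_P p(t;\alpha)^\top\big(A(\alpha)x^*(t;\alpha)+b(\alpha)v\big)\,\lambda(d\alpha)-\eta|v|\Big)=\operatorname*{arg\,max}_{v\in[-1,1]}\big\{\varphi(t)v-\eta|v|\big\},$$ where $\varphi(t)=\int_P p(t;\alpha)^\top b(\alpha)\,\lambda(d\alpha)$ is the averaged switching function. -/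

import Mathlib

open MeasureTheory Set
open scoped Matrix Gradient RealInnerProductSpace ENNReal

/-- Data of the robust `L¹` optimal control problem: minimize `∫₀ᵀ |u(t)| dt` over scalar controls
`u` with values in `[-1, 1]`, subject to `ẋ(t;α) = A(α) x(t;α) + b(α) u(t)`, `x(0;α) = x₀` and
`ψ(x(T;α)) ≤ 0` for all parameters `α ∈ P`. -/
structure RobustOCP (d ν : ℕ) where
  /-- time horizon -/
  T : ℝ
  /-- uncertainty set -/
  P : Set (EuclideanSpace ℝ (Fin ν))
  /-- system matrix -/
  A : EuclideanSpace ℝ (Fin ν) → Matrix (Fin d) (Fin d) ℝ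
  /-- input vector -/
  b : EuclideanSpace ℝ (Fin ν) → EuclideanSpace ℝ (Fin d)
  /-- common initial state -/
  x₀ : EuclideanSpace ℝ (Fin d)
  /-- terminal constraint function -/
  ψ : EuclideanSpace ℝ (Fin d) → ℝ

namespace RobustOCP

variable {d ν : ℕ} (S : RobustOCP d ν)

/-- Standing assumptions on the data. Continuous differentiability of the matrix-valued map `A` is
that of its entries. -/
structure Standing : Prop where
  T_pos : 0 < S.T
  P_nonempty : S.P.Nonempty
  P_compact : IsCompact S.P
  P_convex : Convex ℝ S.P
  smooth : ∃ O : Set (EuclideanSpace ℝ (Fin ν)), IsOpen O ∧ S.P ⊆ O ∧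
    (∀ i j, ContDiffOn ℝ 1 (fun α => S.A α i j) O) ∧ ContDiffOn ℝ 1 S.b O
  ψ_contDiff : ContDiff ℝ 1 S.ψ
  ψ_convex : ConvexOn ℝ univ S.ψ
  C_compact : IsCompact {ξ | S.ψ ξ ≤ 0}

/-- Admissible controls: (classes of) functions in `L^∞([0,T])` with values in `[-1,1]` a.e. -/
def AdmissibleControl (u : ℝ → ℝ) : Prop :=
  MemLp u ∞ (volume.restrict (Icc 0 S.T)) ∧
    ∀ᵐ t ∂(volume.restrict (Icc 0 S.T)), u t ∈ Icc (-1 : ℝ) 1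

/-- `y` is an absolutely continuous solution on `[0,T]` of `ẏ = A(α) y + b(α) u`, `y(0) = x₀`. -/
def IsTrajectory (u : ℝ → ℝ) (α : EuclideanSpace ℝ (Fin ν))
    (y : ℝ → EuclideanSpace ℝ (Fin d)) : Prop :=
  AbsolutelyContinuousOnInterval y 0 S.T ∧ y 0 = S.x₀ ∧
    ∀ᵐ t ∂(volume.restrict (Icc 0 S.T)),
      HasDerivAt y (Matrix.toEuclideanLin (S.A α) (y t) + u t • S.b α) t

/-- Feasible processes: an admissible control, the trajectories `x α = x(·;α)` for `α ∈ P`, and the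
terminal constraint for every `α ∈ P`. -/
def Feasible (u : ℝ → ℝ) (x : EuclideanSpace ℝ (Fin ν) → ℝ → EuclideanSpace ℝ (Fin d)) : Prop :=
  S.AdmissibleControl u ∧ (∀ α ∈ S.P, S.IsTrajectory u α (x α)) ∧
    ∀ α ∈ S.P, S.ψ (x α S.T) ≤ 0

/-- The objective `‖u‖_{L¹}`. -/
noncomputable def cost (u : ℝ → ℝ) : ℝ := ∫ t in Icc 0 S.T, |u t|

/-- Strong local minimizers: feasible processes that are optimal among the feasible processes whose
state trajectories are uniformly close. -/
def IsStrongLocalMin (u : ℝ → ℝ)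
    (x : EuclideanSpace ℝ (Fin ν) → ℝ → EuclideanSpace ℝ (Fin d)) : Prop :=
  S.Feasible u x ∧ ∃ ε > 0, ∀ u' x', S.Feasible u' x' →
    (∀ α ∈ S.P, ∀ t ∈ Icc 0 S.T, ‖x' α t - x α t‖ ≤ ε) → S.cost u ≤ S.cost u'

/-- `p` is an absolutely continuous solution on `[0,T]` of the adjoint equation
`-ṗ = A(α)ᵀ p`. -/
def IsAdjointArc (α : EuclideanSpace ℝ (Fin ν)) (p : ℝ → EuclideanSpace ℝ (Fin d)) : Prop :=
  AbsolutelyContinuousOnInterval p 0 S.T ∧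
    ∀ᵐ t ∂(volume.restrict (Icc 0 S.T)),
      HasDerivAt p (-Matrix.toEuclideanLin (S.A α)ᵀ (p t)) t

/-- The averaged switching function `φ(t) = ∫_P p(t;α)ᵀ b(α) Λ(dα)`. -/
noncomputable def switching (Λ : Measure (EuclideanSpace ℝ (Fin ν)))
    (p : EuclideanSpace ℝ (Fin ν) → ℝ → EuclideanSpace ℝ (Fin d)) (t : ℝ) : ℝ :=
  ∫ α in S.P, ⟪p α t, S.b α⟫ ∂Λ

/-- The averaged Hamiltonian
`∫_P p(t;α)ᵀ (A(α) x(t;α) + b(α) v) Λ(dα) - η |v|`. -/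
noncomputable def hamiltonian (η : ℝ) (Λ : Measure (EuclideanSpace ℝ (Fin ν)))
    (p x : EuclideanSpace ℝ (Fin ν) → ℝ → EuclideanSpace ℝ (Fin d)) (t v : ℝ) : ℝ :=
  (∫ α in S.P, ⟪p α t, Matrix.toEuclideanLin (S.A α) (x α t) + v • S.b α⟫ ∂Λ) - η * |v|

end RobustOCP

/-- The set of maximizers of `f` over `s`. -/
def argmaxOn (f : ℝ → ℝ) (s : Set ℝ) : Set ℝ := {v | v ∈ s ∧ IsMaxOn f s v}

/-! The dynamics are affine in the control, so replacing `u` by `u + s • (v - u)` moves each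
trajectory by exactly `s` times a forced response to `v - u`, bounded uniformly in `α` and `t`. For
small `s > 0` the new process therefore stays in the tube of the strong local minimizer. Convexity
of the cost and of `ψ`, with compactness of `P`, then shows that no admissible `v` makes both the
cost increment and all terminal constraints, linearized at `x α S.T`, strictly negative
(`IsStrongLocalMin.not_strictly_improvable`).

This is a convex system without solution, indexed by the compact set `P`. Separation in `ℝ × C(P,
ℝ)` and the Riesz representation theorem give a scalar `η` and a measure `m` with `η + m(P) = 1`
(`exists_multipliers_of_not_strictly_improvable`); testing with `v = u` gives complementarity.
Variation of constants and Fubini rewrite the averaged first variation through the adjoint arcs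
(`integral_inner_forcedResponse`). Thus `u` maximizes the integral of `φ v - η |v|`, and comparison
with an explicit measurable pointwise maximizer localizes this in time
(`ae_mem_argmaxOn_of_integral_le`). The measure carries all the constraint weight, so `μ = 1` works.
-/

/-! ### Separation and Riesz representation: an abstract multiplier rule. -/

/-- A positive linear functional on `C(K, ℝ)`, `K` compact, is integration against a finite
measure. -/
theorem exists_measure_of_nonneg_functional {K : Type*} [TopologicalSpace K] [CompactSpace K]
    [T2Space K] [MeasurableSpace K] [BorelSpace K] (L : C(K, ℝ) →ₗ[ℝ] ℝ)
    (hL : ∀ h : C(K, ℝ), (∀ a, 0 ≤ h a) → 0 ≤ L h) :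
    ∃ m : Measure K, IsFiniteMeasure m ∧ ∀ h : C(K, ℝ), ∫ a, h a ∂m = L h := by
  let Λ : CompactlySupportedContinuousMap K ℝ →ₚ[ℝ] ℝ :=
  { toFun g := L g.toContinuousMap
    map_add' g g' := L.map_add g.toContinuousMap g'.toContinuousMap
    map_smul' c g := L.map_smul c g.toContinuousMap
    monotone' g g' hgg' := by
      have := hL (g'.toContinuousMap - g.toContinuousMap) (fun a => sub_nonneg.2 (hgg' a))
      rw [map_sub] at this
      exact sub_nonneg.1 this }
  refine ⟨RealRMK.rieszMeasure Λ, inferInstance, fun h => ?_⟩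
  exact RealRMK.integral_rieszMeasure Λ ⟨h, HasCompactSupport.of_compactSpace _⟩

/-- Fritz John multiplier rule for a convex program with constraints indexed by a compact space. -/
theorem exists_multipliers_of_not_strictly_improvable {V K : Type*} [AddCommGroup V] [Module ℝ V]
    [TopologicalSpace K] [CompactSpace K] [T2Space K] [MeasurableSpace K] [BorelSpace K]
    {U : Set V} (hne : U.Nonempty) {J : V → ℝ} (hJ : ConvexOn ℝ U J)
    {G : V → K → ℝ} (hG : ∀ a, ConvexOn ℝ U (fun v => G v a)) (hGc : ∀ v ∈ U, Continuous (G v))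
    (hno : ∀ v ∈ U, J v < 0 → ¬ ∀ a, G v a < 0) :
    ∃ (η : ℝ) (m : Measure K), IsFiniteMeasure m ∧ 0 ≤ η ∧ η + m.real univ = 1 ∧
      ∀ v ∈ U, 0 ≤ η * J v + ∫ a, G v a ∂m := by
  -- All pairs strictly above some `(J v, G v)`: strictness and compactness of `K` make the set
  -- open, convexity of the data makes it convex, and `0 ∈ C` is what `hno` forbids.
  let C : Set (ℝ × C(K, ℝ)) := {q | ∃ v ∈ U, J v < q.1 ∧ ∀ a, G v a < q.2 a}
  have hCopen : IsOpen C := by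
    have : C = ⋃ v ∈ U, {q : ℝ × C(K, ℝ) | J v < q.1 ∧ ∀ a, G v a < q.2 a} := by
      ext q; simp [C, and_left_comm]
    rw [this]
    refine isOpen_biUnion fun v hv => ?_
    have h1 : IsOpen {k : C(K, ℝ) | MapsTo k univ (Ioi 0)} :=
      ContinuousMap.isOpen_setOfPred_mapsTo isCompact_univ isOpen_Ioi
    have h2 : Continuous fun q : ℝ × C(K, ℝ) => q.2 - ⟨G v, hGc v hv⟩ := by fun_prop
    have h3 : {q : ℝ × C(K, ℝ) | ∀ a, G v a < q.2 a} =
        (fun q : ℝ × C(K, ℝ) => q.2 - ⟨G v, hGc v hv⟩) ⁻¹' {k | MapsTo k univ (Ioi 0)} := by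
      ext q
      simp [MapsTo]
    exact (isOpen_lt continuous_const continuous_fst).inter
      (h3 ▸ h1.preimage h2 : IsOpen {q : ℝ × C(K, ℝ) | ∀ a, G v a < q.2 a})
  have hCconv : Convex ℝ C := by
    rintro ⟨r, h⟩ ⟨v, hv, h1, h2⟩ ⟨r', h'⟩ ⟨v', hv', h1', h2'⟩ s t hs ht hst
    have key : ∀ {p q p' q' : ℝ}, p < q → p' < q' → s * p + t * p' < s * q + t * q' := by
      intro p q p' q' h h'
      rcases hs.eq_or_lt with rfl | hs
      · have : t = 1 := by linarith
        subst this; simpa using h'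
      · have := mul_lt_mul_of_pos_left h hs
        have := mul_le_mul_of_nonneg_left h'.le ht
        linarith
    refine ⟨s • v + t • v', hJ.1 hv hv' hs ht hst, ?_, fun a => ?_⟩
    · exact (hJ.2 hv hv' hs ht hst).trans_lt (key h1 h1')
    · exact ((hG a).2 hv hv' hs ht hst).trans_lt (key (h2 a) (h2' a))
  have h0 : (0 : ℝ × C(K, ℝ)) ∉ C := by
    rintro ⟨v, hv, h1, h2⟩
    exact hno v hv h1 h2
  obtain ⟨f, hf⟩ := geometric_hahn_banach_point_open hCconv hCopen h0
  simp only [map_zero] at hf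
  let L : C(K, ℝ) →ₗ[ℝ] ℝ := f.toLinearMap ∘ₗ LinearMap.inr ℝ ℝ C(K, ℝ)
  let c : ℝ := f (1, 0)
  have hfd : ∀ r h, f (r, h) = c * r + L h := by
    intro r h
    have : ((r, h) : ℝ × C(K, ℝ)) = r • (1, 0) + (0, h) := by simp
    rw [this, map_add, map_smul, smul_eq_mul, mul_comm]
    rfl
  -- The pair `(J v, G v)` itself need not lie in `C`, so it is lifted by `e` in every component.
  have hclos : ∀ v (hv : v ∈ U), ∀ e > 0,
      0 < c * J v + L ⟨G v, hGc v hv⟩ + e * (c + L 1) := by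
    intro v hv e he
    have := hf (J v + e, ⟨G v, hGc v hv⟩ + e • 1)
      ⟨v, hv, by simp [he], fun a => by simp [he]⟩
    rw [hfd, map_add, map_smul, smul_eq_mul] at this
    linarith
  obtain ⟨v₀, hv₀⟩ := hne
  -- Nonnegative pairs are recession directions of `C`. If `f` were negative along one, the step
  -- length `n` below would reach a point of `C` where `f` vanishes.
  have hrec : ∀ r h, 0 ≤ r → (∀ a, 0 ≤ (h : C(K, ℝ)) a) → 0 ≤ c * r + L h := by
    intro r h hr hh
    by_contra! hneg
    set M := c * J v₀ + L ⟨G v₀, hGc v₀ hv₀⟩ + 1 * (c + L 1)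
    have hM : 0 < M := hclos v₀ hv₀ 1 one_pos
    set n : ℝ := M / -(c * r + L h)
    have hn : 0 ≤ n := div_nonneg hM.le (by linarith)
    have := hf (J v₀ + 1 + n * r, ⟨G v₀, hGc v₀ hv₀⟩ + 1 + n • h)
      ⟨v₀, hv₀, by have := mul_nonneg hn hr; linarith, fun a => by
        have := mul_nonneg hn (hh a)
        simp only [ContinuousMap.add_apply, ContinuousMap.coe_mk, ContinuousMap.one_apply,
          ContinuousMap.smul_apply, smul_eq_mul]
        linarith⟩
    rw [hfd, map_add, map_add, map_smul, smul_eq_mul] at this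
    have h3 : n * (c * r + L h) = -M := by
      simp only [n]
      field_simp [hneg.ne]
    have : 0 < M + n * (c * r + L h) := by simp only [M]; linarith
    linarith
  have hc : 0 ≤ c := by simpa using hrec 1 0 zero_le_one (by simp)
  have hL : ∀ h : C(K, ℝ), (∀ a, 0 ≤ h a) → 0 ≤ L h := by
    intro h hh
    simpa using hrec 0 h le_rfl hh
  have hL1 : 0 ≤ L 1 := hL 1 (by simp)
  -- Otherwise `c = 0` and, by positivity, `L (G v₀) ≤ B * L 1 = 0`, against `hclos`.
  have hpos : 0 < c + L 1 := by
    refine lt_of_le_of_ne (add_nonneg hc hL1) fun h => ?_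
    have hc0 : c = 0 := by linarith
    have hL0 : L 1 = 0 := by linarith
    obtain ⟨B, hB⟩ := (isCompact_univ.exists_bound_of_continuousOn (hGc v₀ hv₀).continuousOn)
    have h1 := hclos v₀ hv₀ 1 one_pos
    have h2 : 0 ≤ L (B • 1 - ⟨G v₀, hGc v₀ hv₀⟩) := hL _ fun a => by
      have := (le_abs_self _).trans (hB a (mem_univ a))
      simp [this]
    rw [map_sub, map_smul, smul_eq_mul] at h2
    rw [hc0, hL0] at h1
    rw [hL0] at h2
    linarith
  obtain ⟨m, hm, hmL⟩ := exists_measure_of_nonneg_functional ((c + L 1)⁻¹ • L) fun h hh =>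
    mul_nonneg (inv_nonneg.2 hpos.le) (hL h hh)
  refine ⟨(c + L 1)⁻¹ * c, m, hm, mul_nonneg (inv_nonneg.2 hpos.le) hc, ?_, fun v hv => ?_⟩
  · have := hmL 1
    simp only [ContinuousMap.one_apply, integral_const, smul_eq_mul, mul_one,
      LinearMap.smul_apply] at this
    rw [this, ← mul_add, inv_mul_cancel₀ hpos.ne']
  · have h1 := hmL ⟨G v, hGc v hv⟩
    simp only [ContinuousMap.coe_mk, LinearMap.smul_apply, smul_eq_mul] at h1
    rw [h1, mul_assoc, ← mul_add]
    refine mul_nonneg (inv_nonneg.2 hpos.le) ?_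
    by_contra! hneg
    -- This `e` makes the expression in `hclos` equal to zero.
    have := hclos v hv (-(c * J v + L ⟨G v, hGc v hv⟩) / (c + L 1))
      (div_pos (by linarith) hpos)
    rw [div_mul_cancel₀ _ hpos.ne'] at this
    linarith

/-! ### Linear systems: flow, variation of constants, dependence on parameters. -/

section LinearSystem

variable {E : Type*} [NormedAddCommGroup E] [NormedSpace ℝ E]

/-- An absolutely continuous family of operators applied to an absolutely continuous curve is
absolutely continuous. -/
theorem AbsolutelyContinuousOnInterval.clm_apply {f : ℝ → E →L[ℝ] E} {g : ℝ → E} {a b : ℝ}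
    (hf : AbsolutelyContinuousOnInterval f a b) (hg : AbsolutelyContinuousOnInterval g a b) :
    AbsolutelyContinuousOnInterval (fun t => f t (g t)) a b := by
  obtain ⟨C, hC⟩ := hf.exists_bound
  obtain ⟨D, hD⟩ := hg.exists_bound
  unfold AbsolutelyContinuousOnInterval at hf hg
  apply squeeze_zero' ?_ ?_
    (by simpa using (hg.const_mul C).add (hf.const_mul D))
  · exact Filter.Eventually.of_forall <| fun _ ↦ Finset.sum_nonneg (fun i hi ↦ dist_nonneg)
  rw [Filter.eventually_inf_principal]
  filter_upwards with (n, I) hnI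
  simp only [Finset.mul_sum, ← Finset.sum_add_distrib]
  gcongr with i hi
  have h1 := hC _ (hnI.left i hi).left
  have h2 := hD _ (hnI.left i hi).right
  simp only [dist_eq_norm]
  calc ‖f (I i).1 (g (I i).1) - f (I i).2 (g (I i).2)‖
      = ‖f (I i).1 (g (I i).1 - g (I i).2) + (f (I i).1 - f (I i).2) (g (I i).2)‖ := by
        simp
    _ ≤ ‖f (I i).1‖ * ‖g (I i).1 - g (I i).2‖ + ‖f (I i).1 - f (I i).2‖ * ‖g (I i).2‖ :=
        (norm_add_le _ _).trans
          (add_le_add (ContinuousLinearMap.le_opNorm _ _) (ContinuousLinearMap.le_opNorm _ _))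
    _ ≤ C * ‖g (I i).1 - g (I i).2‖ + ‖f (I i).1 - f (I i).2‖ * D := by gcongr
    _ = _ := by ring

/-- The primitive of an essentially bounded function is absolutely continuous. -/
theorem absolutelyContinuousOnInterval_primitive_of_bounded {g : ℝ → E} {T C : ℝ} (hT : 0 ≤ T)
    (hg : IntervalIntegrable g volume 0 T)
    (hC : ∀ᵐ t ∂(volume.restrict (Icc 0 T)), ‖g t‖ ≤ C) :
    AbsolutelyContinuousOnInterval (fun t => ∫ s in 0..t, g s) 0 T := by
  have hC' : ∀ᵐ t, t ∈ Icc 0 T → ‖g t‖ ≤ C := (ae_restrict_iff' measurableSet_Icc).1 hC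
  have hsub : ∀ t ∈ Icc 0 T, IntervalIntegrable g volume 0 t := fun t ht =>
    hg.mono_set (by rw [uIcc_of_le hT, uIcc_of_le ht.1]; exact Icc_subset_Icc_right ht.2)
  refine LipschitzOnWith.absolutelyContinuousOnInterval (K := C.toNNReal)
    (LipschitzOnWith.of_dist_le_mul fun x hx y hy => ?_)
  rw [uIcc_of_le hT] at hx hy
  rw [dist_eq_norm, intervalIntegral.integral_interval_sub_left (hsub x hx) (hsub y hy),
    Real.dist_eq]
  refine intervalIntegral.norm_integral_le_of_norm_le_const_ae ?_
  filter_upwards [hC'] with t ht hmem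
  exact (ht ((convex_Icc (0 : ℝ) T).ordConnected.uIcc_subset hy hx
    (uIoc_subset_uIcc hmem))).trans (Real.le_coe_toNNReal C)

/-- The flow `exp (t a)` of the linear system `ẏ = a y`. -/
noncomputable def linearFlow (a : E →L[ℝ] E) (t : ℝ) : E →L[ℝ] E := NormedSpace.exp (t • a)

@[simp]
theorem linearFlow_zero (a : E →L[ℝ] E) : linearFlow a 0 = 1 := by simp [linearFlow]

variable [CompleteSpace E]

theorem continuous_linearFlow :
    Continuous fun q : (E →L[ℝ] E) × ℝ => linearFlow q.1 q.2 := by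
  let _ : NormedAlgebra ℚ (E →L[ℝ] E) := NormedAlgebra.restrictScalars ℚ ℝ _
  exact NormedSpace.exp_continuous.comp (continuous_snd.smul continuous_fst)

theorem Continuous.linearFlow {X : Type*} [TopologicalSpace X] {a : X → E →L[ℝ] E} {t : X → ℝ}
    (ha : Continuous a) (ht : Continuous t) : Continuous fun x => linearFlow (a x) (t x) :=
  continuous_linearFlow.comp (ha.prodMk ht)

theorem hasDerivAt_linearFlow (a : E →L[ℝ] E) (t : ℝ) :
    HasDerivAt (linearFlow a) (a * linearFlow a t) t :=
  hasDerivAt_exp_smul_const' a t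

theorem hasDerivAt_linearFlow' (a : E →L[ℝ] E) (t : ℝ) :
    HasDerivAt (linearFlow a) (linearFlow a t * a) t :=
  hasDerivAt_exp_smul_const a t

theorem linearFlow_add (a : E →L[ℝ] E) (s t : ℝ) :
    linearFlow a (s + t) = linearFlow a s * linearFlow a t := by
  let _ : NormedAlgebra ℚ (E →L[ℝ] E) := NormedAlgebra.restrictScalars ℚ ℝ _
  rw [linearFlow, add_smul]
  exact NormedSpace.exp_add_of_commute (((Commute.refl a).smul_left s).smul_right t)

theorem linearFlow_apply_neg (a : E →L[ℝ] E) (t : ℝ) (y : E) :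
    linearFlow a t (linearFlow a (-t) y) = y := by
  have := linearFlow_add a t (-t)
  rw [add_neg_cancel, linearFlow_zero] at this
  exact (DFunLike.congr_fun this y).symm

theorem absolutelyContinuousOnInterval_linearFlow (a : E →L[ℝ] E) (s t : ℝ) :
    AbsolutelyContinuousOnInterval (linearFlow a) s t := by
  refine ContDiffOn.absolutelyContinuousOnInterval (ContDiff.contDiffOn ?_)
  refine contDiff_one_iff_deriv.2 ⟨fun t => (hasDerivAt_linearFlow a t).differentiableAt, ?_⟩
  rw [funext fun t => (hasDerivAt_linearFlow a t).deriv]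
  exact continuous_const.mul (continuous_const.linearFlow continuous_id)

/-- The solution of `ẏ = a y + h b`, `y 0 = 0`. -/
noncomputable def forcedResponse (a : E →L[ℝ] E) (b : E) (h : ℝ → ℝ) (t : ℝ) : E :=
  linearFlow a t (∫ s in 0..t, h s • linearFlow a (-s) b)

variable {a : E →L[ℝ] E} {b : E} {h : ℝ → ℝ} {T C : ℝ}

theorem intervalIntegrable_smul_linearFlow (hh : IntervalIntegrable h volume 0 T) :
    IntervalIntegrable (fun s => h s • linearFlow a (-s) b) volume 0 T :=
  hh.smul_continuousOn
    ((continuous_const.linearFlow continuous_neg).clm_apply continuous_const).continuousOn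

theorem IntervalIntegrable.of_mem_Icc {F : Type*} [NormedAddCommGroup F] {g : ℝ → F}
    (hg : IntervalIntegrable g volume 0 T) {t : ℝ} (ht : t ∈ Icc 0 T) :
    IntervalIntegrable g volume 0 t :=
  hg.mono_set (by rw [uIcc_of_le (ht.1.trans ht.2), uIcc_of_le ht.1]; exact Icc_subset_Icc_right ht.2)

theorem forcedResponse_add_smul {h' : ℝ → ℝ} (hh : IntervalIntegrable h volume 0 T)
    (hh' : IntervalIntegrable h' volume 0 T) (c : ℝ) {t : ℝ} (ht : t ∈ Icc 0 T) :
    forcedResponse a b (h + c • h') t = forcedResponse a b h t + c • forcedResponse a b h' t := by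
  unfold forcedResponse
  rw [← map_smul, ← map_add, ← intervalIntegral.integral_smul]
  have := intervalIntegral.integral_add
    (intervalIntegrable_smul_linearFlow (a := a) (b := b) (hh.of_mem_Icc ht))
    ((intervalIntegrable_smul_linearFlow (a := a) (b := b) (hh'.of_mem_Icc ht)).smul c)
  simp only [Pi.smul_apply] at this
  rw [← this]
  simp [add_smul, mul_smul]

theorem forcedResponse_eq_integral (hh : IntervalIntegrable h volume 0 T) :
    forcedResponse a b h T = ∫ s in 0..T, h s • linearFlow a (T - s) b := by
  unfold forcedResponse
  rw [← ContinuousLinearMap.intervalIntegral_comp_comm _ (intervalIntegrable_smul_linearFlow hh)]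
  simp [sub_eq_add_neg, linearFlow_add]

theorem absolutelyContinuousOnInterval_forcedResponse (hT : 0 ≤ T)
    (hh : IntervalIntegrable h volume 0 T)
    (hC : ∀ᵐ t ∂(volume.restrict (Icc 0 T)), |h t| ≤ C) :
    AbsolutelyContinuousOnInterval (forcedResponse a b h) 0 T := by
  have hc : Continuous fun s => linearFlow a (-s) b :=
    (continuous_const.linearFlow continuous_neg).clm_apply continuous_const
  obtain ⟨D, hD⟩ := isCompact_Icc.exists_bound_of_continuousOn (s := Icc 0 T) hc.continuousOn
  refine (absolutelyContinuousOnInterval_linearFlow a 0 T).clm_apply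
    (absolutelyContinuousOnInterval_primitive_of_bounded (C := C * D) hT
      (intervalIntegrable_smul_linearFlow hh) ?_)
  filter_upwards [hC, ae_restrict_mem measurableSet_Icc] with t ht hmem
  rw [norm_smul]
  exact mul_le_mul ht (hD t hmem) (norm_nonneg _) ((abs_nonneg _).trans ht)

/-- With the flow factored out, the integrand no longer depends on `t`, so Lebesgue differentiation
and the product rule suffice. -/
theorem ae_hasDerivAt_forcedResponse (hT : 0 ≤ T) (hh : IntervalIntegrable h volume 0 T) :
    ∀ᵐ t ∂(volume.restrict (Icc 0 T)),
      HasDerivAt (forcedResponse a b h) (a (forcedResponse a b h t) + h t • b) t := by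
  rw [ae_restrict_iff' measurableSet_Icc]
  filter_upwards [(intervalIntegrable_smul_linearFlow (a := a) (b := b) hh).ae_hasDerivAt_integral]
    with t ht hmem
  rw [uIcc_of_le hT] at ht
  have := (hasDerivAt_linearFlow a t).clm_apply (ht hmem 0 (left_mem_Icc.2 hT))
  convert! this using 1
  simp [forcedResponse, linearFlow_apply_neg]

/-- Variation of constants: absolutely continuous solutions of `ẏ = a y + h b` are unique. -/
theorem eq_linearFlow_add_forcedResponse {y : ℝ → E} (hT : 0 ≤ T)
    (hh : IntervalIntegrable h volume 0 T)
    (hC : ∀ᵐ t ∂(volume.restrict (Icc 0 T)), |h t| ≤ C)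
    (hy : AbsolutelyContinuousOnInterval y 0 T)
    (hd : ∀ᵐ t ∂(volume.restrict (Icc 0 T)), HasDerivAt y (a (y t) + h t • b) t)
    {t : ℝ} (ht : t ∈ Icc 0 T) :
    y t = linearFlow a t (y 0) + forcedResponse a b h t := by
  let z : ℝ → E := fun t => y t - forcedResponse a b h t
  have hz : AbsolutelyContinuousOnInterval z 0 T :=
    hy.sub (absolutelyContinuousOnInterval_forcedResponse hT hh hC)
  have hneg : AbsolutelyContinuousOnInterval (fun t => linearFlow a (-t)) 0 T := by
    have : (fun t => linearFlow a (-t)) = linearFlow (-a) := by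
      ext1 t; simp [linearFlow]
    rw [this]
    exact absolutelyContinuousOnInterval_linearFlow _ _ _
  -- The difference `z` solves the homogeneous equation, so `linearFlow a (-t) (z t)` has zero
  -- derivative a.e.; absolute continuity makes it constant.
  obtain ⟨c, hc⟩ := (hneg.clm_apply hz).const_of_ae_hasDerivAt_zero (by
    have h1 := (ae_restrict_iff' measurableSet_Icc).1 hd
    have h2 := (ae_restrict_iff' measurableSet_Icc).1
      (ae_hasDerivAt_forcedResponse (a := a) (b := b) hT hh)
    filter_upwards [h1, h2] with t h1 h2 hmem
    rw [uIcc_of_le hT] at hmem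
    have h3 := (h1 hmem).sub (h2 hmem)
    have h4 : HasDerivAt (fun t => linearFlow a (-t)) (-(linearFlow a (-t) * a)) t := by
      have h5 := (hasDerivAt_linearFlow' a (-t)).scomp t (hasDerivAt_neg t)
      rw [neg_one_smul] at h5
      exact h5
    convert! h4.clm_apply h3 using 1
    simp)
  rw [uIcc_of_le hT] at hc
  have h0 := hc 0 (left_mem_Icc.2 hT)
  have h1 := hc t ht
  rw [← h0] at h1
  have h2 := congrArg (linearFlow a t) h1
  rw [linearFlow_apply_neg] at h2
  simp only [z, forcedResponse, neg_zero, linearFlow_zero, intervalIntegral.integral_same,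
    map_zero, sub_zero, one_apply_eq_self] at h2
  exact sub_eq_iff_eq_add.1 h2

variable {X : Type*} [TopologicalSpace X] [CompactSpace X] {α : X → E →L[ℝ] E} {β : X → E}

/-- Dominated convergence: the kernel is jointly continuous, hence bounded on the compact set `X ×
[0, t]`. -/
theorem continuous_forcedResponse [FirstCountableTopology X] (hα : Continuous α)
    (hβ : Continuous β) (hh : IntervalIntegrable h volume 0 T) {t : ℝ} (ht : t ∈ Icc 0 T) :
    Continuous fun x => forcedResponse (α x) (β x) h t := by
  refine (hα.linearFlow continuous_const).clm_apply ?_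
  have hk : Continuous fun q : X × ℝ => linearFlow (α q.1) (-q.2) (β q.1) :=
    ((hα.comp continuous_fst).linearFlow continuous_snd.neg).clm_apply (hβ.comp continuous_fst)
  obtain ⟨D, hD⟩ := (isCompact_univ.prod isCompact_Icc).exists_bound_of_continuousOn
    (s := univ ×ˢ Icc 0 t) hk.continuousOn
  have hht := hh.of_mem_Icc ht
  refine intervalIntegral.continuous_of_dominated_interval (bound := fun s => ‖h s‖ * D)
    (fun x => ?_) (fun x => ?_) (hht.norm.mul_const D) ?_
  · exact (intervalIntegrable_smul_linearFlow hht).aestronglyMeasurable_restrict_uIoc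
  · refine Filter.Eventually.of_forall fun s hs => ?_
    rw [uIoc_of_le ht.1] at hs
    rw [norm_smul]
    exact mul_le_mul_of_nonneg_left (hD (x, s) ⟨mem_univ _, Ioc_subset_Icc_self hs⟩) (norm_nonneg _)
  · refine Filter.Eventually.of_forall fun s _ => continuous_const.smul ?_
    exact (hα.linearFlow continuous_const).clm_apply hβ

/-- One bound for all parameters and times is what keeps perturbed trajectories inside the tube of a
strong local minimizer. -/
theorem exists_forcedResponse_bound (hα : Continuous α) (hβ : Continuous β)
    (hC : ∀ᵐ t ∂(volume.restrict (Icc 0 T)), |h t| ≤ C) :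
    ∃ M, ∀ x, ∀ t ∈ Icc 0 T, ‖forcedResponse (α x) (β x) h t‖ ≤ M := by
  have hk : Continuous fun q : X × ℝ => linearFlow (α q.1) (-q.2) (β q.1) :=
    ((hα.comp continuous_fst).linearFlow continuous_snd.neg).clm_apply (hβ.comp continuous_fst)
  have hl : Continuous fun q : X × ℝ => linearFlow (α q.1) q.2 :=
    (hα.comp continuous_fst).linearFlow continuous_snd
  have hcomp : IsCompact ((univ : Set X) ×ˢ Icc 0 T) := isCompact_univ.prod isCompact_Icc
  obtain ⟨D, hD⟩ := hcomp.exists_bound_of_continuousOn hk.continuousOn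
  obtain ⟨D', hD'⟩ := hcomp.exists_bound_of_continuousOn hl.continuousOn
  refine ⟨D' * (|C| * |D| * T), fun x t ht => ?_⟩
  refine (ContinuousLinearMap.le_opNorm _ _).trans
    (mul_le_mul (hD' (x, t) ⟨mem_univ _, ht⟩) ?_ (norm_nonneg _)
      ((norm_nonneg _).trans (hD' (x, t) ⟨mem_univ _, ht⟩)))
  refine (intervalIntegral.norm_integral_le_of_norm_le_const_ae (C := |C| * |D|) ?_).trans ?_
  · filter_upwards [(ae_restrict_iff' measurableSet_Icc).1 hC] with s hs hmem
    rw [uIoc_of_le ht.1] at hmem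
    have hs' : s ∈ Icc 0 T := ⟨hmem.1.le, hmem.2.trans ht.2⟩
    rw [norm_smul]
    exact mul_le_mul ((hs hs').trans (le_abs_self _))
      ((hD (x, s) ⟨mem_univ _, hs'⟩).trans (le_abs_self _)) (norm_nonneg _) (abs_nonneg _)
  · rw [sub_zero, abs_of_nonneg ht.1]
    exact mul_le_mul_of_nonneg_left ht.2 (by positivity)

end LinearSystem

/-! ### Convex gradients, Fubini, and passage from integral to pointwise maximality. -/

/-- First order inequality for a differentiable convex function. -/
theorem ConvexOn.le_add_inner_gradient {E : Type*} [NormedAddCommGroup E] [InnerProductSpace ℝ E]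
    [CompleteSpace E] {f : E → ℝ} (hf : ConvexOn ℝ univ f) (hd : Differentiable ℝ f) (y w : E)
    {s : ℝ} (hs : 0 < s) : f (y + s • w) ≤ f y + s * ⟪∇ f (y + s • w), w⟫ := by
  have hline : HasDerivAt (fun r : ℝ => y + r • w) w s := by
    simpa using ((hasDerivAt_id s).smul_const w).const_add y
  have hder : HasDerivAt (fun r : ℝ => f (y + r • w)) ⟪∇ f (y + s • w), w⟫ s := by
    have := (hd (y + s • w)).hasGradientAt.hasFDerivAt.comp_hasDerivAt s hline
    rw [InnerProductSpace.toDual_apply_apply] at this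
    exact this
  have hconv : ConvexOn ℝ univ (fun r : ℝ => f (y + r • w)) := by
    refine ⟨convex_univ, fun p _ q _ c d hc hd' hcd => ?_⟩
    have := hf.2 (mem_univ (y + p • w)) (mem_univ (y + q • w)) hc hd' hcd
    have e : c • (y + p • w) + d • (y + q • w) = y + (c • p + d • q) • w := by
      have : y = (c + d) • y := by rw [hcd, one_smul]
      conv_rhs => rw [this]
      simp only [smul_eq_mul]
      module
    rwa [e] at this
  -- A secant slope is at most the derivative at its right end, which is why the gradient is taken
  -- at `y + s • w`.
  have := hconv.slope_le_of_hasDerivAt (mem_univ 0) (mem_univ s) hs hder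
  rw [slope_def_field, div_le_iff₀ (by linarith)] at this
  simp only [zero_smul, add_zero, sub_zero] at this
  linarith

theorem continuous_gradient {E : Type*} [NormedAddCommGroup E] [InnerProductSpace ℝ E]
    [CompleteSpace E] {f : E → ℝ} (hf : ContDiff ℝ 1 f) : Continuous (∇ f) :=
  (InnerProductSpace.toDual ℝ E).symm.continuous.comp (hf.continuous_fderiv (by norm_num))

/-- Exchange of the order of integration for an integrable weight and a continuous kernel on a
compact set. -/
theorem integral_integral_mul_swap_of_continuous {K : Type*} [TopologicalSpace K] [CompactSpace K]
    [SecondCountableTopology K] [MeasurableSpace K] [BorelSpace K] (m : Measure K)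
    [IsFiniteMeasure m] {k : K → ℝ → ℝ} (hk : Continuous (Function.uncurry k)) {h : ℝ → ℝ}
    {T : ℝ} (hh : IntegrableOn h (Icc 0 T)) :
    ∫ a, (∫ s in Icc 0 T, h s * k a s) ∂m = ∫ s in Icc 0 T, h s * ∫ a, k a s ∂m := by
  rw [integral_integral_swap]
  · simp only [integral_const_mul]
  · obtain ⟨D, hD⟩ := (isCompact_univ.prod isCompact_Icc).exists_bound_of_continuousOn
      (s := (univ : Set K) ×ˢ Icc 0 T) hk.continuousOn
    refine Integrable.mul_bdd (c := D) ?_ hk.aestronglyMeasurable ?_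
    · exact hh.comp_snd m
    · have h2 : m.prod (volume.restrict (Icc 0 T)) =
          (m.prod volume).restrict ((univ : Set K) ×ˢ Icc 0 T) := by
        rw [← Measure.prod_restrict, Measure.restrict_univ]
      rw [h2]
      filter_upwards [ae_restrict_mem (MeasurableSet.univ.prod measurableSet_Icc)] with q hq
      exact hD q hq

/-- If `φ v - η |v|` integrated over an interval is maximal at `u` among all measurable functions
with values in `[-1, 1]`, then `u` maximizes the integrand almost everywhere. -/
theorem ae_mem_argmaxOn_of_integral_le {φ u : ℝ → ℝ} {η T : ℝ} (hη : 0 ≤ η) (hφ : Continuous φ)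
    (hu : AEStronglyMeasurable u (volume.restrict (Icc 0 T)))
    (hu1 : ∀ᵐ t ∂(volume.restrict (Icc 0 T)), u t ∈ Icc (-1 : ℝ) 1)
    (hopt : ∀ v : ℝ → ℝ, Measurable v → (∀ t, v t ∈ Icc (-1 : ℝ) 1) →
      ∫ t in Icc 0 T, (φ t * v t - η * |v t|) ≤ ∫ t in Icc 0 T, (φ t * u t - η * |u t|)) :
    ∀ᵐ t ∂(volume.restrict (Icc 0 T)),
      u t ∈ argmaxOn (fun v => φ t * v - η * |v|) (Icc (-1) 1) := by
  obtain ⟨v, hv, hv1, hmax⟩ : ∃ v : ℝ → ℝ, Measurable v ∧ (∀ t, v t ∈ Icc (-1 : ℝ) 1) ∧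
      ∀ t, ∀ w ∈ Icc (-1 : ℝ) 1, φ t * w - η * |w| ≤ φ t * v t - η * |v t| := by
    -- The bang-off-bang control: an explicit formula makes a measurable selection theorem
    -- unnecessary.
    refine ⟨fun t => if η < φ t then 1 else if φ t < -η then -1 else 0, ?_, fun t => ?_,
      fun t w hw => ?_⟩
    · exact Measurable.ite (measurableSet_lt measurable_const hφ.measurable) measurable_const
        (Measurable.ite (measurableSet_lt hφ.measurable measurable_const) measurable_const
          measurable_const)
    · dsimp only
      split_ifs <;> norm_num
    · obtain ⟨h1, h2⟩ := hw
      have hw0 : 0 ≤ |w| := abs_nonneg w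
      have hw1 : |w| ≤ 1 := abs_le.2 ⟨h1, h2⟩
      have h3 := le_abs_self w
      have h4 := neg_abs_le w
      dsimp only
      split_ifs with c1 c2
      · rw [abs_one]; nlinarith
      · rw [abs_neg, abs_one]; nlinarith
      · rw [abs_zero]; nlinarith
  have hint : ∀ w : ℝ → ℝ, AEStronglyMeasurable w (volume.restrict (Icc 0 T)) →
      (∀ᵐ t ∂(volume.restrict (Icc 0 T)), w t ∈ Icc (-1 : ℝ) 1) →
      Integrable (fun t => φ t * w t - η * |w t|) (volume.restrict (Icc 0 T)) := by
    intro w hw hw1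
    have hb : ∀ᵐ t ∂(volume.restrict (Icc 0 T)), ‖w t‖ ≤ 1 := hw1.mono fun t ht => abs_le.2 ht
    have hwi : Integrable w (volume.restrict (Icc 0 T)) :=
      Integrable.of_bound hw 1 hb
    exact (Integrable.mul_bdd (c := 1) (hφ.continuousOn.integrableOn_Icc) hw hb).sub
      (hwi.abs.const_mul η)
  have hv' := hint v hv.aestronglyMeasurable (Filter.Eventually.of_forall hv1)
  have hu' := hint u hu hu1
  have hnn : 0 ≤ᵐ[volume.restrict (Icc 0 T)]
      fun t => (φ t * v t - η * |v t|) - (φ t * u t - η * |u t|) :=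
    hu1.mono fun t ht => sub_nonneg.2 (hmax t _ ht)
  -- The gap is nonnegative a.e. and `hopt` bounds its integral by zero, so it vanishes a.e.
  have hzero : ∫ t in Icc 0 T, ((φ t * v t - η * |v t|) - (φ t * u t - η * |u t|)) = 0 := by
    refine le_antisymm ?_ (integral_nonneg_of_ae hnn)
    rw [integral_sub hv' hu']
    linarith [hopt v hv hv1]
  filter_upwards [(integral_eq_zero_iff_of_nonneg_ae hnn (hv'.sub hu')).1 hzero, hu1]
    with t ht ht1
  refine ⟨ht1, fun w hw => ?_⟩
  have := hmax t w hw
  simp only [Pi.zero_apply] at ht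
  change φ t * w - η * |w| ≤ φ t * u t - η * |u t|
  linarith

theorem inner_linearFlow_star {E : Type*} [NormedAddCommGroup E] [InnerProductSpace ℝ E]
    [CompleteSpace E] (a : E →L[ℝ] E) (t : ℝ) (ξ y : E) :
    ⟪linearFlow (star a) t ξ, y⟫ = ⟪ξ, linearFlow a t y⟫ := by
  have : linearFlow (star a) t = star (linearFlow a t) := by
    rw [linearFlow, linearFlow, NormedSpace.star_exp, star_smul, star_trivial t]
  rw [this, ContinuousLinearMap.star_eq_adjoint, ContinuousLinearMap.adjoint_inner_left]

/-! ### The control problem: explicit trajectories and admissible controls. -/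

namespace RobustOCP

variable {d ν : ℕ} {S : RobustOCP d ν}

/-- The system matrix as an operator. -/
noncomputable def systemCLM (S : RobustOCP d ν) (α : EuclideanSpace ℝ (Fin ν)) :
    EuclideanSpace ℝ (Fin d) →L[ℝ] EuclideanSpace ℝ (Fin d) :=
  Matrix.toEuclideanCLM (𝕜 := ℝ) (S.A α)

theorem Standing.continuous_systemCLM (hS : S.Standing) :
    Continuous fun α : S.P => S.systemCLM α := by
  obtain ⟨O, -, hPO, hA, -⟩ := hS.smooth
  have h1 : Continuous fun α : S.P => S.A α :=
    continuous_matrix fun i j => ((hA i j).continuousOn.mono hPO).domRestrict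
  have h2 : Continuous (Matrix.toEuclideanCLM (n := Fin d) (𝕜 := ℝ)) :=
    LinearMap.continuous_of_finiteDimensional
      ((Matrix.toEuclideanCLM (n := Fin d) (𝕜 := ℝ)).toAlgEquiv.toLinearMap)
  exact h2.comp h1

theorem Standing.continuous_b (hS : S.Standing) : Continuous fun α : S.P => S.b α := by
  obtain ⟨O, -, hPO, -, hb⟩ := hS.smooth
  exact (hb.continuousOn.mono hPO).domRestrict

variable {u v : ℝ → ℝ} {α : EuclideanSpace ℝ (Fin ν)} {y : ℝ → EuclideanSpace ℝ (Fin d)}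

theorem admissibleControl_iff : S.AdmissibleControl u ↔
    AEStronglyMeasurable u (volume.restrict (Icc 0 S.T)) ∧
      ∀ᵐ t ∂(volume.restrict (Icc 0 S.T)), u t ∈ Icc (-1 : ℝ) 1 :=
  ⟨fun h => ⟨h.1.aestronglyMeasurable, h.2⟩,
    fun h => ⟨memLp_top_of_bound h.1 1 (h.2.mono fun _ ht => abs_le.2 ht), h.2⟩⟩

theorem AdmissibleControl.ae_abs_le (hu : S.AdmissibleControl u) :
    ∀ᵐ t ∂(volume.restrict (Icc 0 S.T)), |u t| ≤ 1 :=
  hu.2.mono fun _ ht => abs_le.2 ht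

theorem AdmissibleControl.integrable (hu : S.AdmissibleControl u) :
    Integrable u (volume.restrict (Icc 0 S.T)) :=
  hu.1.integrable le_top

theorem AdmissibleControl.intervalIntegrable (hS : S.Standing) (hu : S.AdmissibleControl u) :
    IntervalIntegrable u volume 0 S.T :=
  (intervalIntegrable_iff_integrableOn_Icc_of_le hS.T_pos.le).2 hu.integrable

theorem convex_admissibleControl (S : RobustOCP d ν) : Convex ℝ {u | S.AdmissibleControl u} := by
  intro u hu v hv s t hs ht hst
  refine admissibleControl_iff.2 ⟨(hu.1.aestronglyMeasurable.const_smul s).add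
    (hv.1.aestronglyMeasurable.const_smul t), ?_⟩
  filter_upwards [hu.2, hv.2] with r h1 h2
  exact convex_Icc (-1 : ℝ) 1 h1 h2 hs ht hst

theorem convexOn_cost (S : RobustOCP d ν) : ConvexOn ℝ {u | S.AdmissibleControl u} S.cost := by
  refine ⟨S.convex_admissibleControl, fun u hu v hv s t hs ht hst => ?_⟩
  have hu' := AdmissibleControl.integrable hu
  have hv' := AdmissibleControl.integrable hv
  simp only [cost, smul_eq_mul]
  rw [← integral_const_mul, ← integral_const_mul,
    ← integral_add (hu'.abs.const_mul s) (hv'.abs.const_mul t)]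
  refine integral_mono ((hu'.smul s).add (hv'.smul t)).abs
    ((hu'.abs.const_mul s).add (hv'.abs.const_mul t)) fun r => ?_
  simp only [Pi.add_apply, Pi.smul_apply, smul_eq_mul]
  refine (abs_add_le _ _).trans_eq ?_
  rw [abs_mul, abs_mul, abs_of_nonneg hs, abs_of_nonneg ht]

theorem IsTrajectory.eq (hS : S.Standing) (hu : S.AdmissibleControl u)
    (hy : S.IsTrajectory u α y) {t : ℝ} (ht : t ∈ Icc 0 S.T) :
    y t = linearFlow (S.systemCLM α) t S.x₀ + forcedResponse (S.systemCLM α) (S.b α) u t := by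
  have := eq_linearFlow_add_forcedResponse (a := S.systemCLM α) (b := S.b α) hS.T_pos.le
    (hu.intervalIntegrable hS) hu.ae_abs_le hy.1 hy.2.2 ht
  rwa [hy.2.1] at this

theorem isTrajectory_linearFlow_add_forcedResponse (hS : S.Standing) (hu : S.AdmissibleControl u)
    (α : EuclideanSpace ℝ (Fin ν)) :
    S.IsTrajectory u α fun t =>
      linearFlow (S.systemCLM α) t S.x₀ + forcedResponse (S.systemCLM α) (S.b α) u t := by
  refine ⟨?_, by simp [forcedResponse], ?_⟩
  · refine AbsolutelyContinuousOnInterval.fun_add ?_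
      (absolutelyContinuousOnInterval_forcedResponse hS.T_pos.le (hu.intervalIntegrable hS)
        hu.ae_abs_le)
    refine (absolutelyContinuousOnInterval_linearFlow _ _ _).clm_apply ?_
    exact (LipschitzWith.const S.x₀).lipschitzOnWith.absolutelyContinuousOnInterval
  · filter_upwards [ae_hasDerivAt_forcedResponse (a := S.systemCLM α) (b := S.b α) hS.T_pos.le
      (hu.intervalIntegrable hS)] with t ht
    have h1 := (hasDerivAt_linearFlow (S.systemCLM α) t).clm_apply (hasDerivAt_const t S.x₀)
    have h2 := h1.add ht
    have e : ((S.systemCLM α) * linearFlow (S.systemCLM α) t) S.x₀ +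
        linearFlow (S.systemCLM α) t 0 +
        ((S.systemCLM α) (forcedResponse (S.systemCLM α) (S.b α) u t) + u t • S.b α) =
        Matrix.toEuclideanLin (S.A α) (linearFlow (S.systemCLM α) t S.x₀ +
          forcedResponse (S.systemCLM α) (S.b α) u t) + u t • S.b α := by
      rw [map_zero, add_zero, ← add_assoc, map_add]
      rfl
    exact e ▸ h2

/-- Continuity in `α` is not part of feasibility; it follows because uniqueness identifies each `x
α` with the variation of constants formula. -/
theorem continuous_trajectory (hS : S.Standing) (hu : S.AdmissibleControl u)
    {x : EuclideanSpace ℝ (Fin ν) → ℝ → EuclideanSpace ℝ (Fin d)}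
    (hx : ∀ α ∈ S.P, S.IsTrajectory u α (x α)) {t : ℝ} (ht : t ∈ Icc 0 S.T) :
    Continuous fun α : S.P => x α t := by
  have : CompactSpace S.P := isCompact_iff_compactSpace.1 hS.P_compact
  have h1 := ((hS.continuous_systemCLM).linearFlow (continuous_const (y := t))).clm_apply
    (continuous_const (y := S.x₀))
  have h2 := continuous_forcedResponse hS.continuous_systemCLM hS.continuous_b
    (hu.intervalIntegrable hS) ht
  exact (h1.add h2).congr fun α => ((hx α α.2).eq hS hu ht).symm

/-! ### First-order optimality, adjoint arcs and multipliers. -/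

/-- At a strong local minimizer, no admissible control decreases the cost and the linearized
terminal constraints strictly. -/
theorem IsStrongLocalMin.not_strictly_improvable (hS : S.Standing)
    {x : EuclideanSpace ℝ (Fin ν) → ℝ → EuclideanSpace ℝ (Fin d)} (hmin : S.IsStrongLocalMin u x)
    (hv : S.AdmissibleControl v) (hJ : S.cost v < S.cost u) :
    ¬ ∀ α : S.P, S.ψ (x α S.T) + ⟪∇ S.ψ (x α S.T),
      forcedResponse (S.systemCLM α) (S.b α) (v - u) S.T⟫ < 0 := by
  intro hneg
  obtain ⟨⟨hu, hx, hψ⟩, ε, hε, hloc⟩ := hmin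
  have : CompactSpace S.P := isCompact_iff_compactSpace.1 hS.P_compact
  have hTmem : S.T ∈ Icc 0 S.T := right_mem_Icc.2 hS.T_pos.le
  have hui := hu.intervalIntegrable hS
  have hvi := hv.intervalIntegrable hS
  have hC : ∀ᵐ t ∂(volume.restrict (Icc 0 S.T)), |(v - u) t| ≤ 2 := by
    filter_upwards [hu.ae_abs_le, hv.ae_abs_le] with t h1 h2
    refine (abs_sub _ _).trans ?_
    linarith
  obtain ⟨M, hM⟩ := exists_forcedResponse_bound hS.continuous_systemCLM hS.continuous_b hC
  let w : S.P → EuclideanSpace ℝ (Fin d) := fun α =>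
    forcedResponse (S.systemCLM α) (S.b α) (v - u) S.T
  have hw : Continuous w :=
    continuous_forcedResponse hS.continuous_systemCLM hS.continuous_b (hvi.sub hui) hTmem
  have hy : Continuous fun α : S.P => x α S.T := continuous_trajectory hS hu hx hTmem
  -- Joint continuity in `(s, α)` and compactness of `P` allow a single `s` for all `α`; at `s = 0`
  -- the negativity is `hneg`.
  have hΦ : Continuous fun q : ℝ × S.P => S.ψ (x q.2 S.T) +
      ⟪∇ S.ψ (x q.2 S.T + q.1 • w q.2), w q.2⟫ := by
    have hg := continuous_gradient hS.ψ_contDiff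
    have hψc := hS.ψ_contDiff.continuous
    have hy' := hy.comp (continuous_snd (X := ℝ) (Y := S.P))
    have hw' := hw.comp (continuous_snd (X := ℝ) (Y := S.P))
    exact (hψc.comp hy').add ((hg.comp (hy'.add (continuous_fst.smul hw'))).inner hw')
  have hev : ∀ᶠ s : ℝ in nhds 0, ∀ α ∈ (univ : Set S.P), S.ψ (x α S.T) +
      ⟪∇ S.ψ (x α S.T + s • w α), w α⟫ < 0 := by
    refine isCompact_univ.eventually_forall_of_forall_eventually fun α _ => ?_
    refine (hΦ.tendsto (0, α)).eventually_lt_const ?_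
    simpa using hneg α
  have hev2 : ∀ᶠ s : ℝ in nhds 0, s * M < ε := by
    have : Continuous fun s : ℝ => s * M := by fun_prop
    exact (this.tendsto 0).eventually_lt_const (by simpa using hε)
  have hev3 : ∀ᶠ s : ℝ in nhds 0, s < 1 := eventually_lt_nhds zero_lt_one
  obtain ⟨s, hs0, ⟨hs1, hs2⟩, hs3⟩ : ∃ s : ℝ, 0 < s ∧ ((∀ α ∈ (univ : Set S.P), S.ψ (x α S.T) +
      ⟪∇ S.ψ (x α S.T + s • w α), w α⟫ < 0) ∧ s * M < ε) ∧ s < 1 := by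
    have := ((hev.and hev2).and hev3).filter_mono (nhdsWithin_le_nhds (s := Ioi (0 : ℝ)))
    obtain ⟨s, h1, h2⟩ := (this.and self_mem_nhdsWithin).exists
    exact ⟨s, h2, h1⟩
  have hadm : S.AdmissibleControl (u + s • (v - u)) := by
    have := S.convex_admissibleControl hu hv (sub_nonneg.2 hs3.le) hs0.le (by ring)
    convert! this using 1
    module
  have htraj := fun α => isTrajectory_linearFlow_add_forcedResponse hS hadm α
  have hdiff : ∀ α ∈ S.P, ∀ t ∈ Icc 0 S.T,
      linearFlow (S.systemCLM α) t S.x₀ +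
        forcedResponse (S.systemCLM α) (S.b α) (u + s • (v - u)) t =
      x α t + s • forcedResponse (S.systemCLM α) (S.b α) (v - u) t := by
    intro α hα t ht
    rw [(hx α hα).eq hS hu ht, forcedResponse_add_smul (h' := v - u) hui (hvi.sub hui) s ht, add_assoc]
  have hcost := hloc _ _ ⟨hadm, fun α _ => htraj α, fun α hα => ?_⟩ fun α hα t ht => ?_
  · have hconv := S.convexOn_cost.2 hu hv (sub_nonneg.2 hs3.le) hs0.le (by ring)
    have e : (1 - s) • u + s • v = u + s • (v - u) := by module
    rw [e, smul_eq_mul, smul_eq_mul] at hconv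
    nlinarith
  · rw [hdiff α hα _ hTmem]
    -- The resulting bound is `(1 - s) * ψ + s * (ψ + ⟪∇ψ, w⟫)`, with `ψ` at the old endpoint and
    -- `∇ψ` at the new one; both terms are nonpositive since `0 < s < 1`.
    have h1 := hS.ψ_convex.le_add_inner_gradient (hS.ψ_contDiff.differentiable (by norm_num))
      (x α S.T) (w ⟨α, hα⟩) hs0
    have h2 := hs1 ⟨α, hα⟩ (mem_univ _)
    have h3 := hψ α hα
    refine h1.trans ?_
    nlinarith
  · rw [hdiff α hα t ht, add_sub_cancel_left, norm_smul, Real.norm_of_nonneg hs0.le]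
    exact (mul_le_mul_of_nonneg_left (hM ⟨α, hα⟩ t ht) hs0.le).trans hs2.le

theorem systemCLM_star_apply (S : RobustOCP d ν) (α : EuclideanSpace ℝ (Fin ν))
    (y : EuclideanSpace ℝ (Fin d)) :
    star (S.systemCLM α) y = Matrix.toEuclideanLin (S.A α)ᵀ y := by
  rw [systemCLM, ← map_star, Matrix.star_eq_conjTranspose,
    Matrix.conjTranspose_eq_transpose_of_trivial]
  rfl

/-- The solution of `-ṗ = A(α)ᵀ p`, `-p(T) = ξ(α)`. -/
noncomputable def adjointArc (S : RobustOCP d ν)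
    (ξ : EuclideanSpace ℝ (Fin ν) → EuclideanSpace ℝ (Fin d)) (α : EuclideanSpace ℝ (Fin ν))
    (t : ℝ) : EuclideanSpace ℝ (Fin d) :=
  -linearFlow (star (S.systemCLM α)) (S.T - t) (ξ α)

theorem isAdjointArc_adjointArc (S : RobustOCP d ν)
    (ξ : EuclideanSpace ℝ (Fin ν) → EuclideanSpace ℝ (Fin d)) (α : EuclideanSpace ℝ (Fin ν)) :
    S.IsAdjointArc α (S.adjointArc ξ α) := by
  have hd : ∀ t, HasDerivAt (S.adjointArc ξ α)
      (-(star (S.systemCLM α) (S.adjointArc ξ α t))) t := by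
    intro t
    have h1 := (hasDerivAt_linearFlow (star (S.systemCLM α)) (S.T - t)).scomp t
      ((hasDerivAt_id t).const_sub S.T)
    have h2 := (h1.clm_apply (hasDerivAt_const t (ξ α))).neg
    convert! h2 using 1
    simp [adjointArc]
  refine ⟨?_, Filter.Eventually.of_forall fun t => by
    have := hd t
    rwa [systemCLM_star_apply] at this⟩
  refine ContDiffOn.absolutelyContinuousOnInterval (ContDiff.contDiffOn ?_)
  refine contDiff_one_iff_deriv.2 ⟨fun t => (hd t).differentiableAt, ?_⟩
  rw [funext fun t => (hd t).deriv]
  have hc : Continuous (S.adjointArc ξ α) :=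
    continuous_iff_continuousAt.2 fun t => (hd t).continuousAt
  exact ((star (S.systemCLM α)).continuous.comp hc).neg

/-- The forced response is affine in `v`, so the convexity inequality is an equality. -/
theorem convexOn_linearized (hS : S.Standing) {u : ℝ → ℝ} (hu : S.AdmissibleControl u)
    (α : EuclideanSpace ℝ (Fin ν)) (c : ℝ) (ξ : EuclideanSpace ℝ (Fin d)) :
    ConvexOn ℝ {v | S.AdmissibleControl v}
      fun v => c + ⟪ξ, forcedResponse (S.systemCLM α) (S.b α) (v - u) S.T⟫ := by
  refine ⟨S.convex_admissibleControl, fun v hv w hw s t hs ht hst => le_of_eq ?_⟩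
  have hTmem : S.T ∈ Icc 0 S.T := right_mem_Icc.2 hS.T_pos.le
  have hui := hu.intervalIntegrable hS
  have hvu : IntervalIntegrable (v - u) volume 0 S.T :=
    (AdmissibleControl.intervalIntegrable hS hv).sub hui
  have hwu : IntervalIntegrable (w - u) volume 0 S.T :=
    (AdmissibleControl.intervalIntegrable hS hw).sub hui
  have hwv : IntervalIntegrable ((w - u) + (-1 : ℝ) • (v - u)) volume 0 S.T :=
    hwu.add (hvu.smul (-1))
  obtain rfl : s = 1 - t := by linarith
  have e : (1 - t) • v + t • w - u = (v - u) + t • ((w - u) + (-1 : ℝ) • (v - u)) := by module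
  simp only [e, smul_eq_mul]
  rw [forcedResponse_add_smul hvu hwv t hTmem, forcedResponse_add_smul hwu hvu (-1) hTmem]
  simp only [inner_add_right, inner_smul_right]
  ring

/-- Multiplier rule for the linearized problem, with complementarity. -/
theorem IsStrongLocalMin.exists_multipliers (hS : S.Standing) {u : ℝ → ℝ}
    {x : EuclideanSpace ℝ (Fin ν) → ℝ → EuclideanSpace ℝ (Fin d)}
    (hmin : S.IsStrongLocalMin u x) :
    ∃ (η : ℝ) (m : Measure S.P), IsFiniteMeasure m ∧ 0 ≤ η ∧ η + m.real univ = 1 ∧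
      (∀ᵐ α ∂m, S.ψ (x (α : S.P) S.T) = 0) ∧
      ∀ v, S.AdmissibleControl v → 0 ≤ η * (S.cost v - S.cost u) +
        ∫ α : S.P, ⟪∇ S.ψ (x α S.T),
          forcedResponse (S.systemCLM α) (S.b α) (v - u) S.T⟫ ∂m := by
  obtain ⟨⟨hu, hx, hψ⟩, -⟩ := id hmin
  have : CompactSpace S.P := isCompact_iff_compactSpace.1 hS.P_compact
  have hTmem : S.T ∈ Icc 0 S.T := right_mem_Icc.2 hS.T_pos.le
  have hui := hu.intervalIntegrable hS
  have hyT : Continuous fun α : S.P => x α S.T := continuous_trajectory hS hu hx hTmem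
  have hξ : Continuous fun α : S.P => ∇ S.ψ (x α S.T) :=
    (continuous_gradient hS.ψ_contDiff).comp hyT
  have hψc : Continuous fun α : S.P => S.ψ (x α S.T) := hS.ψ_contDiff.continuous.comp hyT
  obtain ⟨η, m, hm, hη, hsum, hopt⟩ := exists_multipliers_of_not_strictly_improvable
    (K := S.P) (U := {v | S.AdmissibleControl v}) (J := fun v => S.cost v + -S.cost u)
    (G := fun v α => S.ψ (x α S.T) + ⟪∇ S.ψ (x α S.T),
      forcedResponse (S.systemCLM α) (S.b α) (v - u) S.T⟫)
    ⟨u, hu⟩ (ConvexOn.add_const S.convexOn_cost (-S.cost u))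
    (fun α => convexOn_linearized hS hu α _ _)
    (fun v hv => hψc.add (hξ.inner (continuous_forcedResponse hS.continuous_systemCLM
      hS.continuous_b ((AdmissibleControl.intervalIntegrable hS hv).sub hui) hTmem)))
    (fun v hv hJ hneg => hmin.not_strictly_improvable hS hv (by linarith) hneg)
  -- For `v = u` the variation vanishes and the multiplier inequality reads `0 ≤ ∫ ψ`, while
  -- feasibility gives `ψ ≤ 0`.
  have hψ0 : ∀ᵐ α ∂m, S.ψ (x (α : S.P) S.T) = 0 := by
    have hle : ∀ᵐ α ∂m, 0 ≤ -S.ψ (x (α : S.P) S.T) :=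
      Filter.Eventually.of_forall fun α => neg_nonneg.2 (hψ α α.2)
    have hi : Integrable (fun α : S.P => -S.ψ (x α S.T)) m := by
      rw [← integrableOn_univ]
      exact hψc.neg.continuousOn.integrableOn_compact isCompact_univ
    have h0 : ∫ α : S.P, -S.ψ (x α S.T) ∂m = 0 := by
      refine le_antisymm ?_ (integral_nonneg_of_ae hle)
      have := hopt u hu
      simp only [sub_self, add_neg_cancel, mul_zero, zero_add, forcedResponse, Pi.zero_apply,
        zero_smul, intervalIntegral.integral_zero, map_zero, inner_zero_right, add_zero] at this
      rw [integral_neg]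
      linarith
    filter_upwards [(integral_eq_zero_iff_of_nonneg_ae hle hi).1 h0] with α hα
    exact neg_eq_zero.1 hα
  refine ⟨η, m, hm, hη, hsum, hψ0, fun v hv => ?_⟩
  have h1 := hopt v hv
  rwa [← sub_eq_add_neg, integral_congr_ae (hψ0.mono fun α hα => by
    simp only [hα, zero_add]; rfl)] at h1

theorem continuous_adjointArc (hS : S.Standing)
    {ξ : EuclideanSpace ℝ (Fin ν) → EuclideanSpace ℝ (Fin d)}
    (hξ : Continuous fun α : S.P => ξ α) :
    Continuous fun q : S.P × ℝ => S.adjointArc ξ q.1 q.2 := by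
  have h1 : Continuous fun q : S.P × ℝ => star (S.systemCLM q.1) :=
    (ContinuousLinearMap.adjoint.continuous.comp hS.continuous_systemCLM).comp continuous_fst
  exact ((h1.linearFlow (continuous_const.sub continuous_snd)).clm_apply
    (hξ.comp continuous_fst)).neg

/-- The averaged first variation of the terminal constraint in terms of the adjoint arcs. -/
theorem integral_inner_forcedResponse (hS : S.Standing)
    {ξ : EuclideanSpace ℝ (Fin ν) → EuclideanSpace ℝ (Fin d)}
    (hξ : Continuous fun α : S.P => ξ α) (m : Measure S.P) [IsFiniteMeasure m] {h : ℝ → ℝ}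
    (hh : IntegrableOn h (Icc 0 S.T)) :
    ∫ α : S.P, ⟪ξ α, forcedResponse (S.systemCLM α) (S.b α) h S.T⟫ ∂m =
      -∫ t in Icc 0 S.T, h t * ∫ α : S.P, ⟪S.adjointArc ξ α t, S.b α⟫ ∂m := by
  have : CompactSpace S.P := isCompact_iff_compactSpace.1 hS.P_compact
  have hT0 := hS.T_pos.le
  have hhi : IntervalIntegrable h volume 0 S.T :=
    (intervalIntegrable_iff_integrableOn_Icc_of_le hT0).2 hh
  -- Moving the flow over time `S.T - t` from `b` onto `ξ` yields minus the adjoint arc at time `t`.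
  have h1 : ∀ α : S.P, ⟪ξ α, forcedResponse (S.systemCLM α) (S.b α) h S.T⟫ =
      -∫ t in Icc 0 S.T, h t * ⟪S.adjointArc ξ α t, S.b α⟫ := by
    intro α
    rw [forcedResponse_eq_integral hhi, intervalIntegral.integral_of_le hT0,
      ← integral_Icc_eq_integral_Ioc, ← integral_neg, ← integral_inner]
    · refine integral_congr_ae (Filter.Eventually.of_forall fun t => ?_)
      simp only [adjointArc, inner_neg_left, inner_linearFlow_star, inner_smul_right]
      ring
    · refine (intervalIntegrable_iff_integrableOn_Icc_of_le hT0).1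
        (hhi.smul_continuousOn (Continuous.continuousOn ?_))
      exact (continuous_const.linearFlow (continuous_const.sub continuous_id)).clm_apply
        continuous_const
  simp only [h1]
  rw [integral_neg, integral_integral_mul_swap_of_continuous m
    (k := fun (α : S.P) t => ⟪S.adjointArc ξ α t, S.b α⟫)
    ((continuous_adjointArc hS hξ).inner (hS.continuous_b.comp continuous_fst)) hh]

end RobustOCP

/-! ### Assembly of the maximum principle. -/

/-- Robust Pontryagin maximum principle for the robust `L¹` problem. The conjuncts are, in order:
the range of `η`; `Λ` is a Radon measure on `P`; normalization; the multipliers `η` and `μ(·)` are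
not simultaneously zero; adjoint equation; transversality; support and complementarity;
well-definedness of the integrals; Hamiltonian maximization. -/
theorem mainTheorem2 {d ν : ℕ} (S : RobustOCP d ν) (hS : S.Standing)
    (u : ℝ → ℝ) (x : EuclideanSpace ℝ (Fin ν) → ℝ → EuclideanSpace ℝ (Fin d))
    (hmin : S.IsStrongLocalMin u x) :
    ∃ (η : ℝ) (Λ : Measure (EuclideanSpace ℝ (Fin ν)))
      (p : EuclideanSpace ℝ (Fin ν) → ℝ → EuclideanSpace ℝ (Fin d))
      (μ : EuclideanSpace ℝ (Fin ν) → ℝ),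
      η ∈ Icc (0 : ℝ) 1 ∧
      (Λ.Regular ∧ Λ S.Pᶜ = 0) ∧
      ENNReal.ofReal η + Λ S.P = 1 ∧
      ¬ (η = 0 ∧ ∀ᵐ α ∂Λ, μ α = 0) ∧
      (∀ᵐ α ∂Λ, S.IsAdjointArc α (p α)) ∧
      (∀ᵐ α ∂Λ, 0 ≤ μ α ∧ -p α S.T = μ α • ∇ S.ψ (x α S.T)) ∧
      (Λ.support ⊆ {α | α ∈ S.P ∧ S.ψ (x α S.T) = 0} ∧
        ∀ α ∈ Λ.support, 0 < μ α → S.ψ (x α S.T) = 0) ∧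
      (∀ t ∈ Icc 0 S.T, IntegrableOn (fun α => p α t) S.P Λ ∧
        IntegrableOn (fun α => ⟪p α t, S.b α⟫) S.P Λ ∧
        IntegrableOn (fun α => ⟪p α t, Matrix.toEuclideanLin (S.A α) (x α t)⟫) S.P Λ) ∧
      ∀ᵐ t ∂(volume.restrict (Icc 0 S.T)),
        u t ∈ argmaxOn (S.hamiltonian η Λ p x t) (Icc (-1) 1) ∧
        argmaxOn (S.hamiltonian η Λ p x t) (Icc (-1) 1) =
          argmaxOn (fun v => S.switching Λ p t * v - η * |v|) (Icc (-1) 1) := by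
  obtain ⟨⟨hu, hx, -⟩, -⟩ := id hmin
  have : CompactSpace S.P := isCompact_iff_compactSpace.1 hS.P_compact
  have hT0 := hS.T_pos.le
  have hTmem : S.T ∈ Icc 0 S.T := right_mem_Icc.2 hT0
  have hPm : MeasurableSet S.P := hS.P_compact.measurableSet
  have ha := hS.continuous_systemCLM
  have hb := hS.continuous_b
  have hyT : Continuous fun α : S.P => x α S.T := RobustOCP.continuous_trajectory hS hu hx hTmem
  set ξ : EuclideanSpace ℝ (Fin ν) → EuclideanSpace ℝ (Fin d) := fun α => ∇ S.ψ (x α S.T)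
  have hξ : Continuous fun α : S.P => ξ α := (continuous_gradient hS.ψ_contDiff).comp hyT
  have hψc : Continuous fun α : S.P => S.ψ (x α S.T) := hS.ψ_contDiff.continuous.comp hyT
  obtain ⟨η, m, hm, hη, hsum, hψ0, hopt⟩ := hmin.exists_multipliers hS
  have hme : MeasurableEmbedding (Subtype.val : S.P → EuclideanSpace ℝ (Fin ν)) :=
    MeasurableEmbedding.subtype_coe hPm
  -- The multiplier measure lives on the subtype `P`; its pushforward is concentrated on `P` in the
  -- ambient space.
  obtain ⟨Λ, hΛ⟩ : ∃ Λ : Measure (EuclideanSpace ℝ (Fin ν)), Λ = m.map Subtype.val := ⟨_, rfl⟩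
  have hΛc : Λ S.Pᶜ = 0 := by
    rw [hΛ, hme.map_apply]; simp
  have hΛP : Λ S.P = m univ := by
    rw [hΛ, hme.map_apply]; simp
  have hΛr : Λ.restrict S.P = Λ := Measure.restrict_eq_self_of_ae_mem hΛc
  have hfin : IsFiniteMeasure Λ := hΛ ▸ Measure.isFiniteMeasure_map _ _
  have hint : ∀ {F : Type} [NormedAddCommGroup F] {f : EuclideanSpace ℝ (Fin ν) → F},
      Continuous (fun α : S.P => f α) → IntegrableOn f S.P Λ := by
    intro F _ f hf
    rw [IntegrableOn, hΛr, hΛ, hme.integrable_map_iff, ← integrableOn_univ]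
    exact hf.continuousOn.integrableOn_compact isCompact_univ
  have hintegral : ∀ f : EuclideanSpace ℝ (Fin ν) → ℝ, ∫ α in S.P, f α ∂Λ = ∫ α : S.P, f α ∂m := by
    intro f
    rw [hΛr, hΛ, hme.integral_map]
  obtain ⟨p, hp⟩ : ∃ p, p = S.adjointArc ξ := ⟨_, rfl⟩
  have hpc : Continuous fun q : S.P × ℝ => p q.1 q.2 := by
    rw [hp]
    exact RobustOCP.continuous_adjointArc hS hξ
  have hkc : Continuous fun q : S.P × ℝ => ⟪p q.1 q.2, S.b q.1⟫ :=
    hpc.inner (hb.comp continuous_fst)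
  have hpt : ∀ t, Continuous fun α : S.P => p α t := fun t =>
    hpc.comp (continuous_id.prodMk continuous_const)
  have hint2 : ∀ t, IntegrableOn (fun α => ⟪p α t, S.b α⟫) S.P Λ := fun t =>
    hint ((hpt t).inner hb)
  have hint3 : ∀ t ∈ Icc 0 S.T,
      IntegrableOn (fun α => ⟪p α t, Matrix.toEuclideanLin (S.A α) (x α t)⟫) S.P Λ := fun t ht =>
    hint ((hpt t).inner (ha.clm_apply (RobustOCP.continuous_trajectory hS hu hx ht)))
  have hsw : ∀ t, ∫ α : S.P, ⟪p α t, S.b α⟫ ∂m = S.switching Λ p t := fun t =>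
    (hintegral fun α => ⟪p α t, S.b α⟫).symm
  have hφ : Continuous (S.switching Λ p) := by
    have h1 : S.switching Λ p = fun t => ∫ α : S.P in univ, ⟪p α t, S.b α⟫ ∂m := by
      ext t
      rw [← hsw, Measure.restrict_univ]
    rw [h1]
    refine continuous_parametric_integral_of_continuous ?_ isCompact_univ
    exact hkc.comp continuous_swap
  have hsupp : Λ.support ⊆ {α | α ∈ S.P ∧ S.ψ (x α S.T) = 0} := by
    have e : {α | α ∈ S.P ∧ S.ψ (x α S.T) = 0} =
        Subtype.val '' {α : S.P | S.ψ (x α S.T) = 0} := by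
      ext α; simp [and_comm]
    -- The active set is closed, as the image of a compact set, and has full measure.
    refine Measure.support_subset_of_isClosed ?_ ?_
    · rw [e]
      exact ((isClosed_eq hψc continuous_const).isCompact.image continuous_subtype_val).isClosed
    · have : ∀ᵐ α ∂Λ, α ∈ S.P ∧ S.ψ (x α S.T) = 0 :=
        hΛ ▸ hme.ae_map_iff.2 (hψ0.mono fun α hα => ⟨α.2, hα⟩)
      exact this
  -- The drift term does not depend on `v`, so both objectives have the same maximizers.
  have hham : ∀ t ∈ Icc 0 S.T, ∀ v, S.hamiltonian η Λ p x t v =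
      (∫ α in S.P, ⟪p α t, Matrix.toEuclideanLin (S.A α) (x α t)⟫ ∂Λ) +
        (S.switching Λ p t * v - η * |v|) := by
    intro t ht v
    simp only [RobustOCP.hamiltonian, RobustOCP.switching, inner_add_right, inner_smul_right]
    rw [integral_add (hint3 t ht) ((hint2 t).const_mul v), integral_const_mul]
    ring
  have harg : ∀ t ∈ Icc 0 S.T, argmaxOn (S.hamiltonian η Λ p x t) (Icc (-1) 1) =
      argmaxOn (fun v => S.switching Λ p t * v - η * |v|) (Icc (-1) 1) := by
    intro t ht
    ext v
    simp only [argmaxOn, isMaxOn_iff, mem_ofPred_eq, hham t ht, add_le_add_iff_left]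
  have hmax := ae_mem_argmaxOn_of_integral_le hη hφ hu.1.aestronglyMeasurable hu.2
    fun v hvm hv1 => by
      have hv : S.AdmissibleControl v :=
        RobustOCP.admissibleControl_iff.2 ⟨hvm.aestronglyMeasurable,
          Filter.Eventually.of_forall hv1⟩
      have h1 := hopt v hv
      have hI : ∀ w, S.AdmissibleControl w →
          Integrable (fun t => S.switching Λ p t * w t) (volume.restrict (Icc 0 S.T)) :=
        fun w hw => IntegrableOn.continuousOn_mul hφ.continuousOn hw.integrable isCompact_Icc
      rw [RobustOCP.integral_inner_forcedResponse hS hξ m (hv.integrable.sub hu.integrable)] at h1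
      simp only [← hp, hsw] at h1
      rw [integral_sub (hI v hv) (hv.integrable.abs.const_mul η),
        integral_sub (hI u hu) (hu.integrable.abs.const_mul η), integral_const_mul,
        integral_const_mul]
      have h2 : ∫ t in Icc 0 S.T, (v - u) t * S.switching Λ p t =
          (∫ t in Icc 0 S.T, S.switching Λ p t * v t) -
            ∫ t in Icc 0 S.T, S.switching Λ p t * u t := by
        rw [← integral_sub (hI v hv) (hI u hu)]
        refine integral_congr_ae (Filter.Eventually.of_forall fun t => ?_)
        simp only [Pi.sub_apply]
        ring
      rw [h2] at h1
      simp only [RobustOCP.cost] at h1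
      linarith
  have hη1 : η ≤ 1 := by linarith [measureReal_nonneg (μ := m) (s := univ)]
  have hmass : ENNReal.ofReal η + Λ S.P = 1 := by
    rw [hΛP, ← ofReal_measureReal (measure_ne_top m univ), ← ENNReal.ofReal_add hη
      measureReal_nonneg, hsum, ENNReal.ofReal_one]
  -- With `μ = 1`, simultaneous vanishing of `η` and `μ` would force `Λ = 0`, contradicting `hmass`.
  refine ⟨η, Λ, p, fun _ => 1, ⟨hη, hη1⟩, ⟨inferInstance, hΛc⟩, hmass, ?_, ?_, ?_,
    ⟨hsupp, fun α hα _ => (hsupp hα).2⟩, fun t ht => ⟨hint (hpt t), hint2 t, hint3 t ht⟩, ?_⟩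
  · rintro ⟨rfl, h⟩
    have h0 : Λ = 0 := by
      rw [← ae_eq_bot, ← Filter.empty_mem_iff_bot]
      exact h.mono fun α hα => one_ne_zero hα
    simp [h0] at hmass
  · exact Filter.Eventually.of_forall fun α => hp ▸ S.isAdjointArc_adjointArc ξ α
  · exact Filter.Eventually.of_forall fun α => ⟨zero_le_one, by simp [hp, RobustOCP.adjointArc, ξ]⟩
  · filter_upwards [hmax, ae_restrict_mem measurableSet_Icc] with t ht hmem
    exact ⟨by rw [harg t hmem]; exact ht, harg t hmem⟩
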